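/- Let $\mathfrak H=L^2(\mathbb T;\mathbb C)$ with $\mathbb T=\mathbb R/\mathbb Z$, let $\mathfrak F=\mathfrak F(\mathfrak H)=\bigoplus_{n\ge 0}\mathfrak H^{(n)}$ be the bosonic Fock space, where $\mathfrak H^{(n)}\subset L^2(\mathbb T^n)$ is the space of symmetric functions, and let $\mathcal N=\bigoplus_n n\,\mathbb 1_{\mathfrak H^{(n)}}$ be the number operator. For $u\in\mathfrak H$ let $\xi(u)=e^{-\|u\|^2/2}\bigoplus_{n\ge0}\frac{1}{\sqrt{n!}}u^{\otimes n}$ be the coherent state. A state is a non-negative operator $\Gamma$ on $\mathfrak F$ with $\mathrm{Tr}\,\Gamma=1$. For an orthogonal projection $P$ of finite rank $J$ on $\mathfrak H$, with $Q=\mathbb 1-P$, let $\mathcal U:\mathfrak F\to\mathfrak F(P\mathfrak H)\otimes\mathfrak F(Q\mathfrak H)$ be the canonical unitary (it sends $\xi(u)$ to $\xi(Pu)\otimes\xi(Qu)$), let $\Gamma_P=\mathrm{Tr}_{\mathfrak F(Q\mathfrak H)}[\mathcal U\Gamma\mathcal U^*]$, and for $\varsigma>0$ let the lower symbol of $\Gamma$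 on $P\mathfrak H$ at scale $\varsigma$ be the measure $$d\mu^{\varsigma}_{P,\Gamma}(u)=(\varsigma\pi)^{-J}\,\big\langle \xi(u/\sqrt\varsigma),\Gamma_P\,\xi(u/\sqrt\varsigma)\big\rangle_{\mathfrak F(P\mathfrak H)}\,du ,$$ where $du$ is Lebesgue measure on $P\mathfrak H\simeq\mathbb C^J$. Lemma. Let $K>0$ and $R>K^2$. There exist constants $C=C(K,R)>0$ and $c=c(K,R)>0$, depending only on $K$ and $R$, such that for every $\tau>0$, every state $\Gamma$ on $\mathfrak F$ supported in the sector $\{\mathcal N\le K^2\tau\}$, and every orthogonal projection $P$ on $\mathfrak H$ of finite rank $J\le\tau^{1/8}$, $$\int_{\{u\in P\mathfrak H:\ \|Pu\|^2>R\}}\|Pu\|^6\,d\mu^{\tau^{-1}}_{P,\Gamma}(u)\le C\,e^{-c\tau}.$$ -/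

import Mathlib

open MeasureTheory
open scoped InnerProductSpace TensorProduct

noncomputable section

namespace BoseFock

/-- The one-particle space `L²(𝕋; ℂ)`, with `𝕋 = ℝ / ℤ`. -/
abbrev OneBody : Type := Lp ℂ 2 (volume : Measure UnitAddCircle)

instance : MeasurableSpace OneBody := borel OneBody
instance : BorelSpace OneBody := ⟨rfl⟩

/-- `L²(𝕋ⁿ; ℂ)`, which is the `n`-fold Hilbert tensor power of `L²(𝕋; ℂ)`. -/
abbrev NBody (n : ℕ) : Type := Lp ℂ 2 (volume : Measure (Fin n → UnitAddCircle))

theorem memLp_prod {n : ℕ} (f : Fin n → OneBody) :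
    MemLp (fun x : Fin n → UnitAddCircle => ∏ i, f i (x i)) 2 volume := by
  have hm : AEStronglyMeasurable (fun x : Fin n → UnitAddCircle => ∏ i, f i (x i)) volume := by
    refine Finset.aestronglyMeasurable_fun_prod _ fun i _ => ?_
    exact (Lp.aestronglyMeasurable (f i)).comp_quasiMeasurePreserving
      (Measure.quasiMeasurePreserving_eval _ i)
  rw [memLp_two_iff_integrable_sq_norm hm]
  have h : ∀ i, Integrable (fun x => ‖f i x‖ ^ 2) (volume : Measure UnitAddCircle) := fun i =>
    (memLp_two_iff_integrable_sq_norm (Lp.aestronglyMeasurable (f i))).1 (Lp.memLp (f i))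
  simp only [norm_prod, ← Finset.prod_pow]
  exact Integrable.fintype_prod h

/-- The product function `f₁ ⊗ ⋯ ⊗ fₙ`, that is `x ↦ f₁(x₁) ⋯ fₙ(xₙ)`. -/
def tensor {n : ℕ} (f : Fin n → OneBody) : NBody n := (memLp_prod f).toLp _

theorem tensor_coe {n : ℕ} (f : Fin n → OneBody) :
    tensor f =ᵐ[volume] fun x => ∏ i, f i (x i) := (memLp_prod f).coeFn_toLp

theorem inner_tensor {n : ℕ} (f g : Fin n → OneBody) :
    ⟪tensor f, tensor g⟫_ℂ = ∏ i, ⟪f i, g i⟫_ℂ := by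
  simp only [L2.inner_def]
  rw [← integral_fintype_prod_volume_eq_prod]
  refine integral_congr_ae ?_
  filter_upwards [tensor_coe f, tensor_coe g] with x hf hg
  simp [hf, hg, Finset.prod_mul_distrib, RCLike.inner_apply]

theorem norm_tensor {n : ℕ} (f : Fin n → OneBody) : ‖tensor f‖ = ∏ i, ‖f i‖ := by
  have h := inner_tensor f f
  simp only [inner_self_eq_norm_sq_to_K] at h
  rw [Finset.prod_pow] at h
  have h' : ‖tensor f‖ ^ 2 = (∏ i, ‖f i‖) ^ 2 := by exact_mod_cast h
  exact (pow_left_inj₀ (norm_nonneg _) (Finset.prod_nonneg fun i _ => norm_nonneg _) two_ne_zero).1 h'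

theorem measurePreserving_perm {n : ℕ} (σ : Equiv.Perm (Fin n)) :
    MeasurePreserving (fun x : Fin n → UnitAddCircle => x ∘ σ) volume volume := by
  convert volume_measurePreserving_piCongrLeft (fun _ : Fin n => UnitAddCircle) σ.symm using 1
  ext x i
  rw [MeasurableEquiv.coe_piCongrLeft]
  simpa using (Equiv.piCongrLeft_apply_apply (fun _ : Fin n => UnitAddCircle) σ.symm x (σ i)).symm

/-- The action of a permutation of the variables on `L²(𝕋ⁿ)`. -/
def permute {n : ℕ} (σ : Equiv.Perm (Fin n)) : NBody n →ₗᵢ[ℂ] NBody n :=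
  Lp.compMeasurePreservingₗᵢ ℂ (fun x => x ∘ σ) (measurePreserving_perm σ)

/-- The bosonic `n`-particle space: the symmetric functions in `L²(𝕋ⁿ)`. -/
def bosonic (n : ℕ) : Submodule ℂ (NBody n) where
  carrier := {Ψ | ∀ σ : Equiv.Perm (Fin n), permute σ Ψ = Ψ}
  add_mem' := fun ha hb σ => by rw [map_add, ha σ, hb σ]
  zero_mem' := fun σ => map_zero _
  smul_mem' := fun c a ha σ => by rw [map_smul, ha σ]

theorem isClosed_bosonic (n : ℕ) : IsClosed (bosonic n : Set (NBody n)) := by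
  have : (bosonic n : Set (NBody n)) = ⋂ σ : Equiv.Perm (Fin n), {Ψ | permute σ Ψ = Ψ} := by
    ext Ψ; simp [bosonic]
  rw [this]
  exact isClosed_iInter fun σ => isClosed_eq (permute σ).continuous continuous_id

instance (n : ℕ) : CompleteSpace (bosonic n) := (isClosed_bosonic n).completeSpace_coe

/-- The bosonic Fock space over `L²(𝕋; ℂ)`. -/
abbrev Fock : Type := lp (fun n : ℕ => bosonic n) 2

/-- The closed subspace `V ⊗ ⋯ ⊗ V` of `L²(𝕋ⁿ)`. -/
def tensorPow (V : Submodule ℂ OneBody) (n : ℕ) : Submodule ℂ (NBody n) :=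
  (Submodule.span ℂ {Ψ | ∃ f : Fin n → OneBody, (∀ i, f i ∈ V) ∧ Ψ = tensor f}).topologicalClosure

/-- The Fock space over `V`, as a closed subspace of the Fock space over
`L²(𝕋; ℂ)`: all components lie in the tensor powers of `V`. -/
def fockOver (V : Submodule ℂ OneBody) : Submodule ℂ Fock where
  carrier := {Φ | ∀ n, (Φ n : NBody n) ∈ tensorPow V n}
  add_mem' := fun ha hb n => add_mem (ha n) (hb n)
  zero_mem' := fun _ => zero_mem _
  smul_mem' := fun c _ ha n => Submodule.smul_mem _ c (ha n)

theorem isClosed_fockOver (V : Submodule ℂ OneBody) : IsClosed (fockOver V : Set Fock) := by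
  have : (fockOver V : Set Fock) = ⋂ n : ℕ, {Φ : Fock | (Φ n : NBody n) ∈ tensorPow V n} := by
    ext Ψ
    rw [Set.mem_iInter]
    exact Iff.rfl
  rw [this]
  refine isClosed_iInter fun n => ?_
  have hc : IsClosed (tensorPow V n : Set (NBody n)) := Submodule.isClosed_topologicalClosure _
  refine hc.preimage (f := fun Φ : Fock => (Φ n : NBody n)) ?_
  exact continuous_subtype_val.comp
    ((continuous_apply n).comp (lp.uniformContinuous_coe (p := 2)).continuous)

/-- The bosonic Fock space over `V`, as a Hilbert space of its own. -/
def FockOver (V : Submodule ℂ OneBody) : Type := fockOver V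

instance (V : Submodule ℂ OneBody) : NormedAddCommGroup (FockOver V) :=
  inferInstanceAs (NormedAddCommGroup (fockOver V))

instance (V : Submodule ℂ OneBody) : InnerProductSpace ℂ (FockOver V) :=
  inferInstanceAs (InnerProductSpace ℂ (fockOver V))

instance (V : Submodule ℂ OneBody) : CompleteSpace (FockOver V) :=
  (isClosed_fockOver V).completeSpace_coe

/-- The inclusion of the Fock space over `V` into the full Fock space. -/
def incl (V : Submodule ℂ OneBody) : FockOver V →ₗᵢ[ℂ] Fock := (fockOver V).subtypeₗᵢ

theorem incl_mem {V : Submodule ℂ OneBody} (φ : FockOver V) : incl V φ ∈ fockOver V :=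
  Subtype.property (p := fun Φ : Fock => Φ ∈ fockOver V) φ

theorem tensorPower_mem (u : OneBody) (n : ℕ) : tensor (fun _ : Fin n => u) ∈ bosonic n := by
  intro σ
  apply Lp.ext
  have h1 := Lp.coeFn_compMeasurePreserving (tensor fun _ : Fin n => u) (measurePreserving_perm σ)
  have h2 := (measurePreserving_perm σ).quasiMeasurePreserving.ae (tensor_coe fun _ : Fin n => u)
  filter_upwards [h1, h2, tensor_coe fun _ : Fin n => u] with x h1 h2 h3
  have h4 : (permute σ (tensor fun _ : Fin n => u)) x = tensor (fun _ : Fin n => u) (x ∘ σ) := h1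
  rw [h4, h2, h3]
  exact Equiv.prod_comp σ fun i => u (x i)

/-- The symmetric tensor power `u ⊗ ⋯ ⊗ u` (`n` factors). -/
def tensorPower (u : OneBody) (n : ℕ) : bosonic n :=
  ⟨tensor fun _ => u, tensorPower_mem u n⟩

theorem memlp_coherent (u : OneBody) :
    Memℓp (fun n : ℕ => (((Real.exp (-‖u‖ ^ 2 / 2) / √(n.factorial : ℝ) : ℝ) : ℂ)) •
      tensorPower u n) 2 := by
  rw [memℓp_gen_iff (by norm_num)]
  have h := (Real.summable_pow_div_factorial (‖u‖ ^ 2)).mul_left (Real.exp (-‖u‖ ^ 2 / 2) ^ 2)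
  refine h.congr fun n => ?_
  have hn : ‖tensorPower u n‖ = ‖u‖ ^ n := by
    change ‖tensor fun _ : Fin n => u‖ = _
    rw [norm_tensor]; simp
  rw [norm_smul, hn, Complex.norm_real, Real.norm_eq_abs, abs_of_nonneg (by positivity)]
  norm_num [mul_pow, div_pow]
  rw [← pow_mul, ← pow_mul, mul_comm 2 n]
  ring

/-- The coherent state `ξ(u) = e^{-‖u‖²/2} ⨁ₙ (n!)^{-1/2} u^{⊗n}`. -/
def coherent (u : OneBody) : Fock := ⟨_, memlp_coherent u⟩

theorem coherent_mem {V : Submodule ℂ OneBody} {u : OneBody} (hu : u ∈ V) :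
    coherent u ∈ fockOver V := fun _ =>
  Submodule.smul_mem _ _ (Submodule.le_topologicalClosure _
    (Submodule.subset_span ⟨fun _ => u, fun _ => hu, rfl⟩))


/-! ### Products over a splitting of the variables -/

theorem memLp_outer {a b : ℕ} (φ : NBody a) (χ : NBody b) :
    MemLp (fun z : (Fin a → UnitAddCircle) × (Fin b → UnitAddCircle) => φ z.1 * χ z.2) 2
      volume := by
  have hm : AEStronglyMeasurable
      (fun z : (Fin a → UnitAddCircle) × (Fin b → UnitAddCircle) => φ z.1 * χ z.2) volume :=
    ((Lp.aestronglyMeasurable φ).comp_quasiMeasurePreserving Measure.quasiMeasurePreserving_fst).mul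
      ((Lp.aestronglyMeasurable χ).comp_quasiMeasurePreserving Measure.quasiMeasurePreserving_snd)
  rw [memLp_two_iff_integrable_sq_norm hm]
  have h1 := (memLp_two_iff_integrable_sq_norm (Lp.aestronglyMeasurable φ)).1 (Lp.memLp φ)
  have h2 := (memLp_two_iff_integrable_sq_norm (Lp.aestronglyMeasurable χ)).1 (Lp.memLp χ)
  simp only [norm_mul, mul_pow]
  exact h1.mul_prod h2

/-- The function `(x, y) ↦ φ(x) χ(y)`. -/
def outer {a b : ℕ} (φ : NBody a) (χ : NBody b) :
    Lp ℂ 2 (volume : Measure ((Fin a → UnitAddCircle) × (Fin b → UnitAddCircle))) :=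
  (memLp_outer φ χ).toLp _

theorem outer_coe {a b : ℕ} (φ : NBody a) (χ : NBody b) :
    outer φ χ =ᵐ[volume] fun z => φ z.1 * χ z.2 := (memLp_outer φ χ).coeFn_toLp

theorem inner_outer {a b : ℕ} (φ φ' : NBody a) (χ χ' : NBody b) :
    ⟪outer φ χ, outer φ' χ'⟫_ℂ = ⟪φ, φ'⟫_ℂ * ⟪χ, χ'⟫_ℂ := by
  simp only [L2.inner_def]
  rw [← integral_prod_mul]
  refine integral_congr_ae ?_
  filter_upwards [outer_coe φ χ, outer_coe φ' χ'] with x hf hg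
  simp only [hf, hg, RCLike.inner_apply, map_mul]
  ring

theorem measurePreserving_split {a b p : ℕ} (e : Fin a ⊕ Fin b ≃ Fin p) :
    MeasurePreserving (fun x : Fin p → UnitAddCircle =>
      ((fun i => x (e (Sum.inl i))), (fun j => x (e (Sum.inr j))))) volume volume := by
  have h1 := volume_measurePreserving_piCongrLeft (fun _ : Fin a ⊕ Fin b => UnitAddCircle) e.symm
  have h2 := volume_measurePreserving_sumPiEquivProdPi (fun _ : Fin a ⊕ Fin b => UnitAddCircle)
  convert h2.comp h1 using 1
  have key : ∀ (x : Fin p → UnitAddCircle) (s : Fin a ⊕ Fin b),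
      MeasurableEquiv.piCongrLeft (fun _ : Fin a ⊕ Fin b => UnitAddCircle) e.symm x s
        = x (e s) := by
    intro x s
    rw [MeasurableEquiv.coe_piCongrLeft]
    simpa using Equiv.piCongrLeft_apply_apply (fun _ : Fin a ⊕ Fin b => UnitAddCircle) e.symm x (e s)
  funext x
  refine Prod.ext ?_ ?_
  · funext i
    exact (key x (Sum.inl i)).symm
  · funext i
    exact (key x (Sum.inr i)).symm

/-- For a splitting `e` of `p` variables into `a` and `b` variables, the function
`x ↦ φ(x ∘ e ∘ inl) χ(x ∘ e ∘ inr)`. -/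
def mix {a b p : ℕ} (e : Fin a ⊕ Fin b ≃ Fin p) (φ : NBody a) (χ : NBody b) : NBody p :=
  Lp.compMeasurePreservingₗᵢ ℂ _ (measurePreserving_split e) (outer φ χ)

theorem mix_coe {a b p : ℕ} (e : Fin a ⊕ Fin b ≃ Fin p) (φ : NBody a) (χ : NBody b) :
    mix e φ χ =ᵐ[volume] fun x => φ (fun i => x (e (Sum.inl i))) * χ (fun j => x (e (Sum.inr j))) := by
  have h1 := Lp.coeFn_compMeasurePreserving (outer φ χ) (measurePreserving_split e)
  have h2 := (measurePreserving_split e).quasiMeasurePreserving.ae (outer_coe φ χ)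
  filter_upwards [h1, h2] with x h1 h2
  exact h1.trans h2

theorem inner_mix {a b p : ℕ} (e : Fin a ⊕ Fin b ≃ Fin p) (φ φ' : NBody a) (χ χ' : NBody b) :
    ⟪mix e φ χ, mix e φ' χ'⟫_ℂ = ⟪φ, φ'⟫_ℂ * ⟪χ, χ'⟫_ℂ := by
  rw [mix, mix, LinearIsometry.inner_map_map, inner_outer]

theorem outer_add_left {a b : ℕ} (φ φ' : NBody a) (χ : NBody b) :
    outer (φ + φ') χ = outer φ χ + outer φ' χ := by
  apply Lp.ext
  have h : ∀ᵐ z : (Fin a → UnitAddCircle) × (Fin b → UnitAddCircle),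
      (φ + φ' : NBody a) z.1 = φ z.1 + φ' z.1 :=
    Measure.quasiMeasurePreserving_fst.ae (Lp.coeFn_add φ φ')
  filter_upwards [outer_coe (φ + φ') χ, outer_coe φ χ, outer_coe φ' χ,
    Lp.coeFn_add (outer φ χ) (outer φ' χ), h] with z h1 h2 h3 h4 h5
  rw [h1, h4, Pi.add_apply, h2, h3, h5, add_mul]

theorem outer_add_right {a b : ℕ} (φ : NBody a) (χ χ' : NBody b) :
    outer φ (χ + χ') = outer φ χ + outer φ χ' := by
  apply Lp.ext
  have h : ∀ᵐ z : (Fin a → UnitAddCircle) × (Fin b → UnitAddCircle),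
      (χ + χ' : NBody b) z.2 = χ z.2 + χ' z.2 :=
    Measure.quasiMeasurePreserving_snd.ae (Lp.coeFn_add χ χ')
  filter_upwards [outer_coe φ (χ + χ'), outer_coe φ χ, outer_coe φ χ',
    Lp.coeFn_add (outer φ χ) (outer φ χ'), h] with z h1 h2 h3 h4 h5
  rw [h1, h4, Pi.add_apply, h2, h3, h5, mul_add]

theorem outer_smul_left {a b : ℕ} (c : ℂ) (φ : NBody a) (χ : NBody b) :
    outer (c • φ) χ = c • outer φ χ := by
  apply Lp.ext
  have h : ∀ᵐ z : (Fin a → UnitAddCircle) × (Fin b → UnitAddCircle),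
      (c • φ : NBody a) z.1 = c • φ z.1 :=
    Measure.quasiMeasurePreserving_fst.ae (Lp.coeFn_smul c φ)
  filter_upwards [outer_coe (c • φ) χ, outer_coe φ χ, Lp.coeFn_smul c (outer φ χ), h]
    with z h1 h2 h3 h4
  rw [h1, h3, Pi.smul_apply, h2, h4, smul_eq_mul, smul_eq_mul, mul_assoc]

theorem outer_smul_right {a b : ℕ} (c : ℂ) (φ : NBody a) (χ : NBody b) :
    outer φ (c • χ) = c • outer φ χ := by
  apply Lp.ext
  have h : ∀ᵐ z : (Fin a → UnitAddCircle) × (Fin b → UnitAddCircle),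
      (c • χ : NBody b) z.2 = c • χ z.2 :=
    Measure.quasiMeasurePreserving_snd.ae (Lp.coeFn_smul c χ)
  filter_upwards [outer_coe φ (c • χ), outer_coe φ χ, Lp.coeFn_smul c (outer φ χ), h]
    with z h1 h2 h3 h4
  rw [h1, h3, Pi.smul_apply, h2, h4, smul_eq_mul, smul_eq_mul, mul_left_comm]

theorem norm_mix {a b p : ℕ} (e : Fin a ⊕ Fin b ≃ Fin p) (φ : NBody a) (χ : NBody b) :
    ‖mix e φ χ‖ = ‖φ‖ * ‖χ‖ := by
  have h := inner_mix e φ φ χ χ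
  simp only [inner_self_eq_norm_sq_to_K] at h
  rw [← mul_pow] at h
  have h' : ‖mix e φ χ‖ ^ 2 = (‖φ‖ * ‖χ‖) ^ 2 := by exact_mod_cast h
  exact (pow_left_inj₀ (norm_nonneg _) (by positivity) two_ne_zero).1 h'

theorem mix_add_left {a b p : ℕ} (e : Fin a ⊕ Fin b ≃ Fin p) (φ φ' : NBody a) (χ : NBody b) :
    mix e (φ + φ') χ = mix e φ χ + mix e φ' χ := by
  rw [mix, outer_add_left, map_add]; rfl

theorem mix_add_right {a b p : ℕ} (e : Fin a ⊕ Fin b ≃ Fin p) (φ : NBody a) (χ χ' : NBody b) :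
    mix e φ (χ + χ') = mix e φ χ + mix e φ χ' := by
  rw [mix, outer_add_right, map_add]; rfl

theorem mix_smul_left {a b p : ℕ} (e : Fin a ⊕ Fin b ≃ Fin p) (c : ℂ) (φ : NBody a)
    (χ : NBody b) : mix e (c • φ) χ = c • mix e φ χ := by
  rw [mix, outer_smul_left, map_smul]; rfl

theorem mix_smul_right {a b p : ℕ} (e : Fin a ⊕ Fin b ≃ Fin p) (c : ℂ) (φ : NBody a)
    (χ : NBody b) : mix e φ (c • χ) = c • mix e φ χ := by
  rw [mix, outer_smul_right, map_smul]; rfl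

/-- `mix` as a continuous bilinear map. -/
def mixL {a b p : ℕ} (e : Fin a ⊕ Fin b ≃ Fin p) : NBody a →L[ℂ] NBody b →L[ℂ] NBody p :=
  LinearMap.mkContinuous₂
    (LinearMap.mk₂ ℂ (mix e) (mix_add_left e) (mix_smul_left e) (mix_add_right e)
      (mix_smul_right e)) 1
    (fun φ χ => by rw [one_mul]; exact (norm_mix e φ χ).le)

theorem mix_tensor {a b p : ℕ} (e : Fin a ⊕ Fin b ≃ Fin p) (f : Fin a → OneBody)
    (g : Fin b → OneBody) :
    mix e (tensor f) (tensor g) = tensor fun i => Sum.elim f g (e.symm i) := by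
  apply Lp.ext
  have h1 := (Measure.quasiMeasurePreserving_fst (ν := (volume : Measure (Fin b → UnitAddCircle)))).ae
    (tensor_coe f)
  have h2 := (Measure.quasiMeasurePreserving_snd (μ := (volume : Measure (Fin a → UnitAddCircle)))).ae
    (tensor_coe g)
  have h1' := (measurePreserving_split e).quasiMeasurePreserving.ae h1
  have h2' := (measurePreserving_split e).quasiMeasurePreserving.ae h2
  filter_upwards [mix_coe e (tensor f) (tensor g), h1', h2',
    tensor_coe fun i => Sum.elim f g (e.symm i)] with x h3 h4 h5 h6
  rw [h3, h6, h4, h5, ← Equiv.prod_comp e, Fintype.prod_sum_type]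
  simp

/-- Products of functions taken from `V` in the variables in `S` and from `Vᗮ` in the others. -/
def mixedSpan (V : Submodule ℂ OneBody) {p : ℕ} (S : Finset (Fin p)) : Submodule ℂ (NBody p) :=
  (Submodule.span ℂ {Ψ | ∃ f : Fin p → OneBody, (∀ i ∈ S, f i ∈ V) ∧ (∀ i ∉ S, f i ∈ Vᗮ) ∧
    Ψ = tensor f}).topologicalClosure

theorem inner_mixedSpan (V : Submodule ℂ OneBody) {p : ℕ} {S S' : Finset (Fin p)} (hS : S ≠ S')
    {Ψ Ψ' : NBody p} (h : Ψ ∈ mixedSpan V S) (h' : Ψ' ∈ mixedSpan V S') : ⟪Ψ, Ψ'⟫_ℂ = 0 := by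
  have key : (mixedSpan V S) ⟂ (mixedSpan V S') := by
    rw [Submodule.isOrtho_iff_le, mixedSpan, mixedSpan, Submodule.orthogonal_closure]
    refine Submodule.topologicalClosure_minimal _ ?_ (Submodule.isClosed_orthogonal _)
    rw [← Submodule.isOrtho_iff_le, Submodule.isOrtho_span]
    rintro _ ⟨f, hf, hf', rfl⟩ _ ⟨g, hg, hg', rfl⟩
    rw [inner_tensor]
    obtain ⟨i, hi⟩ : ∃ i, ¬ (i ∈ S ↔ i ∈ S') := by
      by_contra! hcon
      exact hS (Finset.ext hcon)
    refine Finset.prod_eq_zero (Finset.mem_univ i) ?_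
    by_cases h1 : i ∈ S
    · have h2 : i ∉ S' := fun h2 => hi ⟨fun _ => h2, fun _ => h1⟩
      exact Submodule.inner_right_of_mem_orthogonal (hf i h1) (hg' i h2)
    · have h2 : i ∈ S' := by
        by_contra h2
        exact hi ⟨fun h => absurd h h1, fun h => absurd h h2⟩
      exact Submodule.inner_left_of_mem_orthogonal (hg i h2) (hf' i h1)
  exact Submodule.isOrtho_iff_inner_eq.1 key _ h _ h'

theorem mix_mem_mixedSpan (V : Submodule ℂ OneBody) {a b p : ℕ} (e : Fin a ⊕ Fin b ≃ Fin p)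
    (S : Finset (Fin p)) (hl : ∀ i, e (Sum.inl i) ∈ S) (hr : ∀ j, e (Sum.inr j) ∉ S)
    {φ : NBody a} {χ : NBody b} (hφ : φ ∈ tensorPow V a) (hχ : χ ∈ tensorPow Vᗮ b) :
    mix e φ χ ∈ mixedSpan V S := by
  have hc : IsClosed (mixedSpan V S : Set (NBody p)) := Submodule.isClosed_topologicalClosure _
  have h1 : ∀ f : Fin a → OneBody, (∀ i, f i ∈ V) → ∀ g : Fin b → OneBody, (∀ i, g i ∈ Vᗮ) →
      mix e (tensor f) (tensor g) ∈ mixedSpan V S := by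
    intro f hf g hg
    rw [mix_tensor]
    refine Submodule.le_topologicalClosure _ (Submodule.subset_span ⟨_, ?_, ?_, rfl⟩)
    · intro i hi
      obtain ⟨s, rfl⟩ := e.surjective i
      rcases s with s | s
      · simpa using hf s
      · exact absurd hi (hr s)
    · intro i hi
      obtain ⟨s, rfl⟩ := e.surjective i
      rcases s with s | s
      · exact absurd (hl s) hi
      · simpa using hg s
  have h2 : ∀ f : Fin a → OneBody, (∀ i, f i ∈ V) → mix e (tensor f) χ ∈ mixedSpan V S := by
    intro f hf
    have hle : tensorPow Vᗮ b ≤ (mixedSpan V S).comap (mixL e (tensor f)).toLinearMap := by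
      refine Submodule.topologicalClosure_minimal _ (Submodule.span_le.2 ?_)
        (hc.preimage (mixL e (tensor f)).continuous)
      rintro _ ⟨g, hg, rfl⟩
      exact h1 f hf g hg
    exact hle hχ
  have hle : tensorPow V a ≤ (mixedSpan V S).comap ((mixL e).flip χ).toLinearMap := by
    refine Submodule.topologicalClosure_minimal _ (Submodule.span_le.2 ?_)
      (hc.preimage ((mixL e).flip χ).continuous)
    rintro _ ⟨f, hf, rfl⟩
    exact h2 f hf
  exact hle hφ

theorem permute_mix {a b p : ℕ} (e : Fin a ⊕ Fin b ≃ Fin p) (σ : Equiv.Perm (Fin p))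
    (φ : NBody a) (χ : NBody b) : permute σ (mix e φ χ) = mix (e.trans σ) φ χ := by
  apply Lp.ext
  have h1 := Lp.coeFn_compMeasurePreserving (mix e φ χ) (measurePreserving_perm σ)
  have h2 := (measurePreserving_perm σ).quasiMeasurePreserving.ae (mix_coe e φ χ)
  filter_upwards [h1, h2, mix_coe (e.trans σ) φ χ] with x h1 h2 h3
  rw [h3]
  exact h1.trans h2

theorem mix_sumCongr {a b p : ℕ} (e : Fin a ⊕ Fin b ≃ Fin p) (π : Equiv.Perm (Fin a))
    (ρ : Equiv.Perm (Fin b)) (φ : NBody a) (χ : NBody b) :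
    mix ((Equiv.sumCongr π ρ).trans e) φ χ = mix e (permute π φ) (permute ρ χ) := by
  apply Lp.ext
  have h1 : ∀ᵐ x, (permute π φ) x = φ (x ∘ π) :=
    Lp.coeFn_compMeasurePreserving φ (measurePreserving_perm π)
  have h2 : ∀ᵐ x, (permute ρ χ) x = χ (x ∘ ρ) :=
    Lp.coeFn_compMeasurePreserving χ (measurePreserving_perm ρ)
  have h1' := (measurePreserving_split e).quasiMeasurePreserving.ae
    ((Measure.quasiMeasurePreserving_fst (ν := (volume : Measure (Fin b → UnitAddCircle)))).ae h1)
  have h2' := (measurePreserving_split e).quasiMeasurePreserving.ae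
    ((Measure.quasiMeasurePreserving_snd (μ := (volume : Measure (Fin a → UnitAddCircle)))).ae h2)
  filter_upwards [h1', h2', mix_coe ((Equiv.sumCongr π ρ).trans e) φ χ,
    mix_coe e (permute π φ) (permute ρ χ)] with x h3 h4 h5 h6
  rw [h5, h6, h3, h4]
  rfl

theorem mix_congr (φ χ : ∀ n, bosonic n) {a b a' b' p : ℕ} (e : Fin a ⊕ Fin b ≃ Fin p)
    (e' : Fin a' ⊕ Fin b' ≃ Fin p)
    (h : Set.range (fun i => e (Sum.inl i)) = Set.range (fun i => e' (Sum.inl i))) :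
    mix e (φ a) (χ b) = mix e' (φ a') (χ b') := by
  have ha : a = a' := by
    have h1 := Set.ncard_range_of_injective (e.injective.comp Sum.inl_injective)
    have h2 := Set.ncard_range_of_injective (e'.injective.comp Sum.inl_injective)
    have h3 : (Set.range (e ∘ Sum.inl)).ncard = (Set.range (e' ∘ Sum.inl)).ncard :=
      congrArg Set.ncard h
    simpa [h1, h2] using h3
  subst ha
  have hb : b = b' := by
    have h1 := Fintype.card_congr e
    have h2 := Fintype.card_congr e'
    simp only [Fintype.card_sum, Fintype.card_fin] at h1 h2
    omega
  subst hb
  have hσ : Set.MapsTo (e.trans e'.symm) (Set.range Sum.inl) (Set.range Sum.inl) := by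
    rintro _ ⟨i, rfl⟩
    have : e (Sum.inl i) ∈ Set.range (fun i => e' (Sum.inl i)) := h ▸ ⟨i, rfl⟩
    obtain ⟨j, hj⟩ := this
    exact ⟨j, by simp [← hj]⟩
  obtain ⟨⟨π, ρ⟩, hπ⟩ := Equiv.Perm.mem_sumCongrHom_range_of_perm_mapsTo_inl hσ
  have he : e = (Equiv.sumCongr π ρ).trans e' := by
    have : Equiv.sumCongr π ρ = e.trans e'.symm := hπ
    rw [this]
    ext s
    simp
  rw [he, mix_sumCongr, (φ a).2 π, (χ b).2 ρ]

/-- The splitting of `p` variables into those in `S` and those not in `S`, in increasing order. -/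
def splitting {p : ℕ} (S : Finset (Fin p)) : Fin S.card ⊕ Fin Sᶜ.card ≃ Fin p :=
  finSumEquivOfFinset rfl rfl

theorem range_splitting {p : ℕ} (S : Finset (Fin p)) :
    Set.range (fun i => splitting S (Sum.inl i)) = S :=
  Finset.range_orderEmbOfFin S rfl

/-- The `p`-particle component of the symmetric product of `φ` and `χ`, namely
`x ↦ ∑_S (p choose |S|)^{-1/2} φ(x_S) χ(x_{Sᶜ})`, summed over the subsets `S` of the variables. -/
def productComponent (φ χ : ∀ n, bosonic n) (p : ℕ) : NBody p :=
  ∑ S : Finset (Fin p), (((√(p.choose S.card : ℝ))⁻¹ : ℝ) : ℂ) •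
    mix (splitting S) (φ S.card) (χ Sᶜ.card)

theorem productComponent_mem (φ χ : ∀ n, bosonic n) (p : ℕ) :
    productComponent φ χ p ∈ bosonic p := by
  intro σ
  simp only [productComponent, map_sum, map_smul, permute_mix]
  refine Fintype.sum_equiv (Equiv.finsetCongr σ) _ _ fun S => ?_
  have hc : (Equiv.finsetCongr σ S).card = S.card := by simp [Equiv.finsetCongr]
  rw [mix_congr φ χ ((splitting S).trans σ) (splitting (Equiv.finsetCongr σ S)),
    congrArg (p.choose) hc]
  rw [range_splitting]
  have : (fun i => ((splitting S).trans σ) (Sum.inl i)) = σ ∘ fun i => splitting S (Sum.inl i) := rfl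
  rw [this, Set.range_comp, range_splitting]
  simp [Equiv.finsetCongr]

theorem inner_productComponent (V : Submodule ℂ OneBody) (φ φ' χ χ' : ∀ n, bosonic n)
    (hφ : ∀ n, (φ n : NBody n) ∈ tensorPow V n) (hφ' : ∀ n, (φ' n : NBody n) ∈ tensorPow V n)
    (hχ : ∀ n, (χ n : NBody n) ∈ tensorPow Vᗮ n) (hχ' : ∀ n, (χ' n : NBody n) ∈ tensorPow Vᗮ n)
    (p : ℕ) :
    ⟪productComponent φ χ p, productComponent φ' χ' p⟫_ℂ =
      ∑ kl ∈ Finset.HasAntidiagonal.antidiagonal p, ⟪φ kl.1, φ' kl.1⟫_ℂ * ⟪χ kl.2, χ' kl.2⟫_ℂ := by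
  have hmem : ∀ (φ χ : ∀ n, bosonic n), (∀ n, (φ n : NBody n) ∈ tensorPow V n) →
      (∀ n, (χ n : NBody n) ∈ tensorPow Vᗮ n) → ∀ S : Finset (Fin p),
      mix (splitting S) (φ S.card) (χ Sᶜ.card) ∈ mixedSpan V S := by
    intro φ χ hφ hχ S
    refine mix_mem_mixedSpan V _ S (fun i => ?_) (fun j => ?_) (hφ _) (hχ _)
    · exact Finset.orderEmbOfFin_mem S rfl i
    · exact Finset.mem_compl.1 (Finset.orderEmbOfFin_mem Sᶜ rfl j)
  have hdiag : ∀ S : Finset (Fin p), ⟪productComponent φ χ p,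
      (((√(p.choose S.card : ℝ))⁻¹ : ℝ) : ℂ) • mix (splitting S) (φ' S.card) (χ' Sᶜ.card)⟫_ℂ =
      (fun k => ((p.choose k : ℂ))⁻¹ * (⟪φ k, φ' k⟫_ℂ * ⟪χ (p - k), χ' (p - k)⟫_ℂ)) S.card := by
    intro S
    rw [productComponent, sum_inner, Finset.sum_eq_single S]
    · rw [inner_smul_left, inner_smul_right, inner_mix]
      have hc : Sᶜ.card = p - S.card := by simp [Finset.card_compl]
      have h1 : ⟪(χ Sᶜ.card : NBody Sᶜ.card), (χ' Sᶜ.card : NBody Sᶜ.card)⟫_ℂ =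
          ⟪χ (p - S.card), χ' (p - S.card)⟫_ℂ := by
        rw [← Submodule.coe_inner, hc]
      rw [h1, ← mul_assoc, ← Submodule.coe_inner]
      congr 1
      rw [Complex.conj_ofReal, ← Complex.ofReal_mul, ← mul_inv,
        Real.mul_self_sqrt (Nat.cast_nonneg _)]
      push_cast
      rfl
    · intro T _ hT
      rw [inner_smul_left, inner_smul_right,
        inner_mixedSpan V hT (hmem φ χ hφ hχ T) (hmem φ' χ' hφ' hχ' S)]
      simp
    · simp
  rw [productComponent.eq_1 φ' χ', inner_sum, Finset.sum_congr rfl fun S _ => hdiag S,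
    ← Finset.powerset_univ,
    Finset.sum_powerset_apply_card (fun k =>
      ((p.choose k : ℂ))⁻¹ * (⟪φ k, φ' k⟫_ℂ * ⟪χ (p - k), χ' (p - k)⟫_ℂ)), Finset.card_univ, Fintype.card_fin,
    Finset.Nat.sum_antidiagonal_eq_sum_range_succ_mk]
  refine Finset.sum_congr rfl fun k hk => ?_
  have hk' : (p.choose k : ℂ) ≠ 0 := by
    exact_mod_cast (Nat.choose_pos (Nat.lt_succ_iff.1 (Finset.mem_range.1 hk))).ne'
  rw [nsmul_eq_mul, mul_inv_cancel_left₀ hk']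

theorem summable_sq (Φ : Fock) : Summable fun n => ‖Φ n‖ ^ 2 := by
  have h := (memℓp_gen_iff (p := 2) (by norm_num)).1 (lp.memℓp Φ)
  simpa using h

theorem memlp_product (V : Submodule ℂ OneBody) (φ : FockOver V) (χ : FockOver Vᗮ) :
    Memℓp (fun p => (⟨productComponent (incl V φ) (incl Vᗮ χ) p, productComponent_mem _ _ p⟩ :
      bosonic p)) 2 := by
  rw [memℓp_gen_iff (by norm_num)]
  have h1 : ∀ Φ : Fock, Summable fun n => ‖(‖Φ n‖ ^ 2 : ℝ)‖ := fun Φ => by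
    simpa using summable_sq Φ
  refine (summable_norm_sum_mul_antidiagonal_of_summable_norm (h1 (incl V φ))
    (h1 (incl Vᗮ χ))).congr fun p => ?_
  have h2 := inner_productComponent V (incl V φ) (incl V φ) (incl Vᗮ χ) (incl Vᗮ χ)
    (incl_mem φ) (incl_mem φ) (incl_mem χ) (incl_mem χ) p
  have h3 : ‖productComponent (incl V φ) (incl Vᗮ χ) p‖ ^ 2 =
      ∑ kl ∈ Finset.HasAntidiagonal.antidiagonal p,
        ‖incl V φ kl.1‖ ^ 2 * ‖incl Vᗮ χ kl.2‖ ^ 2 := by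
    have h4 : ∀ (Φ : Fock) (n : ℕ), ⟪Φ n, Φ n⟫_ℂ = ((‖Φ n‖ ^ 2 : ℝ) : ℂ) := fun Φ n =>
      (inner_self_eq_norm_sq_to_K (𝕜 := ℂ) (Φ n)).trans (Complex.ofReal_pow _ _).symm
    have h5 := (inner_self_eq_norm_sq_to_K (𝕜 := ℂ)
      (productComponent (incl V φ) (incl Vᗮ χ) p)).trans (Complex.ofReal_pow _ _).symm
    rw [h5] at h2
    simp only [h4, ← Complex.ofReal_mul, ← Complex.ofReal_sum] at h2
    exact Complex.ofReal_injective h2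
  rw [← h3, Real.norm_of_nonneg (by positivity)]
  norm_num

/-- The symmetric product of `φ` in the Fock space over `V` and `χ` in the Fock space over `Vᗮ`:
its `p`-particle component is `x ↦ ∑_S (p choose |S|)^{-1/2} φ(x_S) χ(x_{Sᶜ})`. -/
def symProduct (V : Submodule ℂ OneBody) (φ : FockOver V) (χ : FockOver Vᗮ) : Fock :=
  ⟨_, memlp_product V φ χ⟩

theorem inner_symProduct (V : Submodule ℂ OneBody) (φ φ' : FockOver V) (χ χ' : FockOver Vᗮ) :
    ⟪symProduct V φ χ, symProduct V φ' χ'⟫_ℂ = ⟪φ, φ'⟫_ℂ * ⟪χ, χ'⟫_ℂ := by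
  have hs : ∀ Φ Ψ : Fock, Summable fun n => ‖⟪Φ n, Ψ n⟫_ℂ‖ := fun Φ Ψ => by
    refine ((summable_sq Φ).add (summable_sq Ψ)).of_nonneg_of_le (fun _ => norm_nonneg _) fun n => ?_
    have := norm_inner_le_norm (𝕜 := ℂ) (Φ n) (Ψ n)
    nlinarith [sq_nonneg (‖Φ n‖ - ‖Ψ n‖), norm_nonneg (Φ n), norm_nonneg (Ψ n)]
  rw [← (incl V).inner_map_map, ← (incl Vᗮ).inner_map_map, lp.inner_eq_tsum, lp.inner_eq_tsum,
    lp.inner_eq_tsum, tsum_mul_tsum_eq_tsum_sum_antidiagonal_of_summable_norm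
      (hs (incl V φ) (incl V φ')) (hs (incl Vᗮ χ) (incl Vᗮ χ'))]
  exact tsum_congr fun p => inner_productComponent V _ _ _ _
    (incl_mem φ) (incl_mem φ') (incl_mem χ) (incl_mem χ') p

/-- The symmetric product as a bilinear map. -/
def symProductₗ (V : Submodule ℂ OneBody) : FockOver V →ₗ[ℂ] FockOver Vᗮ →ₗ[ℂ] Fock :=
  LinearMap.mk₂ ℂ (symProduct V)
    (fun φ φ' χ => by
      refine lp.ext (funext fun p => Subtype.ext ?_)
      change productComponent _ _ p = productComponent _ _ p + productComponent _ _ p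
      simp only [productComponent, ← Finset.sum_add_distrib, ← smul_add]
      refine Finset.sum_congr rfl fun S _ => congrArg _ ?_
      exact mix_add_left (splitting S) _ _ _)
    (fun c φ χ => by
      refine lp.ext (funext fun p => Subtype.ext ?_)
      change productComponent _ _ p = c • productComponent _ _ p
      simp only [productComponent, Finset.smul_sum]
      refine Finset.sum_congr rfl fun S _ => ?_
      rw [smul_comm c]
      exact congrArg _ (mix_smul_left (splitting S) c _ _))
    (fun φ χ χ' => by
      refine lp.ext (funext fun p => Subtype.ext ?_)
      change productComponent _ _ p = productComponent _ _ p + productComponent _ _ p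
      simp only [productComponent, ← Finset.sum_add_distrib, ← smul_add]
      refine Finset.sum_congr rfl fun S _ => congrArg _ ?_
      exact mix_add_right (splitting S) _ _ _)
    (fun c φ χ => by
      refine lp.ext (funext fun p => Subtype.ext ?_)
      change productComponent _ _ p = c • productComponent _ _ p
      simp only [productComponent, Finset.smul_sum]
      refine Finset.sum_congr rfl fun S _ => ?_
      rw [smul_comm c]
      exact congrArg _ (mix_smul_right (splitting S) c _ _))

/-! ### Hilbert tensor products and partial traces -/

section HilbertTensor

variable {K L F : Type} [NormedAddCommGroup K] [InnerProductSpace ℂ K]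
  [NormedAddCommGroup L] [InnerProductSpace ℂ L] [NormedAddCommGroup F] [InnerProductSpace ℂ F]

variable (K L) in
/-- The Hilbert space tensor product: the completion of the algebraic tensor product for
`⟪x ⊗ y, x' ⊗ y'⟫ = ⟪x, x'⟫ ⟪y, y'⟫`. -/
abbrev HilbertTensor : Type := UniformSpace.Completion (K ⊗[ℂ] L)

/-- The map `x ↦ x ⊗ y`. -/
def tensorRight (y : L) : K →L[ℂ] HilbertTensor K L :=
  UniformSpace.Completion.toComplL ∘L (TensorProduct.mkL ℂ K L).flip y

theorem inner_lift (B : K →ₗ[ℂ] L →ₗ[ℂ] F)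
    (hB : ∀ x x' y y', ⟪B x y, B x' y'⟫_ℂ = ⟪x, x'⟫_ℂ * ⟪y, y'⟫_ℂ) (z z' : K ⊗[ℂ] L) :
    ⟪TensorProduct.lift B z, TensorProduct.lift B z'⟫_ℂ = ⟪z, z'⟫_ℂ := by
  induction z using TensorProduct.induction_on with
  | zero => simp
  | add x x' hx hx' => rw [map_add, inner_add_left, inner_add_left, hx, hx']
  | tmul x y =>
    induction z' using TensorProduct.induction_on with
    | zero => simp
    | add y y' hy hy' => rw [map_add, inner_add_right, inner_add_right, hy, hy']
    | tmul x' y' =>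
      rw [TensorProduct.inner_tmul, TensorProduct.lift.tmul, TensorProduct.lift.tmul, hB]

/-- The continuous linear map `x ⊗ y ↦ B(x, y)` on the Hilbert space tensor product, for a bilinear
map `B` with `⟪B(x, y), B(x', y')⟫ = ⟪x, x'⟫ ⟪y, y'⟫`. -/
def hilbertLift [CompleteSpace F] (B : K →ₗ[ℂ] L →ₗ[ℂ] F)
    (hB : ∀ x x' y y', ⟪B x y, B x' y'⟫_ℂ = ⟪x, x'⟫_ℂ * ⟪y, y'⟫_ℂ) :
    HilbertTensor K L →L[ℂ] F :=
  ((TensorProduct.lift B).isometryOfInner (inner_lift B hB)).toContinuousLinearMap.extend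
    UniformSpace.Completion.toComplL

theorem hilbertLift_apply [CompleteSpace F] (B : K →ₗ[ℂ] L →ₗ[ℂ] F)
    (hB : ∀ x x' y y', ⟪B x y, B x' y'⟫_ℂ = ⟪x, x'⟫_ℂ * ⟪y, y'⟫_ℂ) (x : K) (y : L) :
    hilbertLift B hB (tensorRight y x) = B x y :=
  (ContinuousLinearMap.extend_eq _ UniformSpace.Completion.denseRange_coe
    (UniformSpace.Completion.isUniformInducing_coe _) (x ⊗ₜ[ℂ] y)).trans
    (TensorProduct.lift.tmul x y)

/-- The partial trace over the second factor, `∑ⱼ (1 ⊗ ⟨eⱼ|) T (1 ⊗ |eⱼ⟩)`, where `(eⱼ)` is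
an orthonormal basis of the second factor. -/
def partialTrace [CompleteSpace K] [CompleteSpace L]
    (T : HilbertTensor K L →L[ℂ] HilbertTensor K L) : K →L[ℂ] K :=
  ∑' j : (exists_hilbertBasis ℂ L).choose,
    (tensorRight (j : L)).adjoint ∘L T ∘L tensorRight (j : L)

end HilbertTensor

/-- The inverse `𝒰*` of the unitary `𝒰` from the Fock space onto the tensor product of the Fock
spaces over `V` and `Vᗮ`: it takes `φ ⊗ χ` to the symmetric product of `φ` and `χ`. -/
def fockUnitaryInv (V : Submodule ℂ OneBody) :
    HilbertTensor (FockOver V) (FockOver Vᗮ) →L[ℂ] Fock :=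
  hilbertLift (symProductₗ V) (inner_symProduct V)

theorem fockUnitaryInv_apply (V : Submodule ℂ OneBody) (φ : FockOver V) (χ : FockOver Vᗮ) :
    fockUnitaryInv V (tensorRight χ φ) = symProduct V φ χ :=
  hilbertLift_apply (symProductₗ V) (inner_symProduct V) φ χ

/-- The localization `Γ_P = Tr (𝒰 Γ 𝒰*)`, traced over the Fock space over `Vᗮ`, where `V` is
the range of `P`. -/
def localization (Γ : Fock →L[ℂ] Fock) (V : Submodule ℂ OneBody) :
    FockOver V →L[ℂ] FockOver V :=
  partialTrace ((fockUnitaryInv V).adjoint ∘L Γ ∘L fockUnitaryInv V)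

/-! ### States and lower symbols -/

/-- A state: a non-negative operator of trace one. -/
structure IsState (Γ : Fock →L[ℂ] Fock) : Prop where
  isPositive : Γ.IsPositive
  trace_eq_one : ∀ (ι : Type) (b : HilbertBasis ι ℂ Fock), HasSum (fun i => ⟪b i, Γ (b i)⟫_ℂ) 1

/-- `Γ` is supported in the sector `{𝒩 ≤ M}`: its range consists of vectors that have no
component with more than `M` particles. -/
def SupportedBelow (Γ : Fock →L[ℂ] Fock) (M : ℝ) : Prop :=
  ∀ (Φ : Fock) (n : ℕ), M < n → Γ Φ n = 0

/-- Lebesgue measure on a finite-dimensional complex subspace `V ≃ ℂᴶ`. -/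
def lebesgue (V : Submodule ℂ OneBody) [FiniteDimensional ℂ V] : Measure V :=
  Measure.map (fun z : Fin (Module.finrank ℂ V) → ℂ => ∑ i, z i • stdOrthonormalBasis ℂ V i) volume

/-- The coherent state `ξ(u)`, for `u ∈ V`, as a vector in the Fock space over `V`. -/
def coherentOver (V : Submodule ℂ OneBody) (u : V) : FockOver V :=
  ⟨coherent u, coherent_mem u.2⟩

/-- The lower symbol (Husimi function) of `Γ` on `V` at scale `ς`: the measure with density
`(ςπ)^{-dim V} ⟨ξ(u/√ς), Γ_P ξ(u/√ς)⟩`. -/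
def lowerSymbol (ς : ℝ) (Γ : Fock →L[ℂ] Fock) (V : Submodule ℂ OneBody) [FiniteDimensional ℂ V] :
    Measure V :=
  (lebesgue V).withDensity fun u => ENNReal.ofReal
    (((ς * Real.pi) ^ Module.finrank ℂ V)⁻¹ *
      (⟪coherentOver V (((√ς)⁻¹ : ℂ) • u),
        localization Γ V (coherentOver V (((√ς)⁻¹ : ℂ) • u))⟫_ℂ).re)
end BoseFock
end

/-!
The Husimi function of `Γ` on a finite-dimensional `V` is bounded pointwise. Since `Γ` only sees
sectors with at most `M = K² τ` particles, and since the `p`-particle part of `φ ⊗ χ` only involves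
components of `φ` with at most `p` particles, the vector `ξ(v)` in `⟪ξ(v), Γ_P ξ(v)⟫` may be
replaced in each term of the partial trace by its truncation `φ` to at most `M` particles. The
vectors `φ ⊗ eⱼ` are `‖φ‖` times an orthonormal family, so `Tr Γ = 1` gives
`⟪ξ(v), Γ_P ξ(v)⟫ ≤ ‖φ‖²` (`IsState.inner_localization_le`). For `v = √τ u`, the number `‖φ‖²` is
the probability that a Poisson variable with mean `x = τ ‖u‖²` is at most `K² τ`.

For `x ≥ R τ` with `R > K²` the Chernoff bound makes this at most `exp (-κ τ / 2) exp (-b x)`, where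
`κ = rate K R > 0` and `b = κ / (2 R)` (`poisson_sum_le_exp_rate`). The remaining Gaussian
integral over `V ≃ ℂᴶ` absorbs the weight `‖u‖⁶` and the normalization `(τ / π)ᴶ`, and leaves
a factor `(2 / b)ᴶ` (`lintegral_lowerSymbol_le`). As `J ≤ τ^(1/8)`, this factor is
subexponential in `τ` (`pow_le_exp_of_le_rpow`), and half of the decay `exp (-κ τ / 2)` survives.
For `τ < 1` the condition on `J` forces `V = 0`, and there is nothing to integrate.
-/

open MeasureTheory
open scoped InnerProductSpace TensorProduct

namespace BoseFock

/-! ### The localized state and the particle number -/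

/-- The diagonal matrix elements of a state along an orthonormal family sum to at most one, since
the family is part of a Hilbert basis. -/
theorem IsState.sum_inner_le_one {Γ : Fock →L[ℂ] Fock} (hΓ : IsState Γ) {ι : Type}
    {v : ι → Fock} (hv : Orthonormal ℂ v) (s : Finset ι) :
    ∑ i ∈ s, (⟪v i, Γ (v i)⟫_ℂ).re ≤ 1 := by
  obtain ⟨w, b, hw, hb⟩ := hv.toSubtypeRange.exists_hilbertBasis_extension
  have h1 := Complex.hasSum_re (hΓ.trace_eq_one w b)
  let e : ι ↪ w := ⟨fun i => ⟨v i, hw ⟨i, rfl⟩⟩, fun i j hij =>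
    hv.linearIndependent.injective (congrArg Subtype.val hij)⟩
  have h2 := sum_le_hasSum (s.map e)
    (fun i _ => hΓ.isPositive.re_inner_nonneg_right (b i)) h1
  rw [Finset.sum_map, hb] at h2
  exact h2

/-- The truncation of a Fock vector to the sectors with fewer than `m` particles. -/
noncomputable def truncate (m : ℕ) (Φ : Fock) : Fock :=
  ∑ n ∈ Finset.range m, lp.single 2 n (Φ n)

theorem truncate_apply (m : ℕ) (Φ : Fock) (n : ℕ) :
    truncate m Φ n = if n < m then Φ n else 0 := by
  simp only [truncate, lp.coeFn_sum, Finset.sum_apply, lp.coeFn_single, Finset.sum_pi_single,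
    Finset.mem_range]

theorem norm_truncate_sq (m : ℕ) (Φ : Fock) :
    ‖truncate m Φ‖ ^ 2 = ∑ n ∈ Finset.range m, ‖Φ n‖ ^ 2 := by
  have h := lp.norm_sum_single (p := 2) (by norm_num) (fun n => Φ n) (Finset.range m)
  simpa [truncate] using h

theorem truncate_mem {V : Submodule ℂ OneBody} {Φ : Fock} (hΦ : Φ ∈ fockOver V) (m : ℕ) :
    truncate m Φ ∈ fockOver V := fun n => by
  rw [truncate_apply]
  split_ifs
  · exact hΦ n
  · exact zero_mem _

/-- `truncate`, inside the Fock space over `V`. -/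
noncomputable def truncateOver {V : Submodule ℂ OneBody} (m : ℕ) (φ : FockOver V) : FockOver V :=
  ⟨truncate m (incl V φ), truncate_mem (incl_mem φ) m⟩

theorem norm_truncateOver_sq {V : Submodule ℂ OneBody} (m : ℕ) (φ : FockOver V) :
    ‖truncateOver m φ‖ ^ 2 = ∑ n ∈ Finset.range m, ‖incl V φ n‖ ^ 2 :=
  norm_truncate_sq m (incl V φ)

/-- The `p`-particle component of `symProduct V φ χ` only involves the components of `φ` with at
most `p` particles. -/
theorem symProduct_truncateOver_apply {V : Submodule ℂ OneBody} {m p : ℕ} (hp : p < m)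
    (φ : FockOver V) (χ : FockOver Vᗮ) :
    symProduct V (truncateOver m φ) χ p = symProduct V φ χ p := by
  refine Subtype.ext ?_
  change productComponent (truncate m (incl V φ)) _ p = productComponent (incl V φ) _ p
  simp only [productComponent]
  refine Finset.sum_congr rfl fun S _ => ?_
  have hS : S.card < m := lt_of_le_of_lt (by simpa using S.card_le_univ) hp
  rw [truncate_apply, if_pos hS]

/-- The quadratic form of an operator supported on at most `M` particles only sees the components
with at most `M` particles. -/
theorem inner_eq_of_supportedBelow {Γ : Fock →L[ℂ] Fock} (hΓ : Γ.IsPositive) {M : ℝ}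
    (hM : SupportedBelow Γ M) {Φ Ψ : Fock} (h : ∀ n : ℕ, (n : ℝ) ≤ M → Φ n = Ψ n) :
    ⟪Φ, Γ Φ⟫_ℂ = ⟪Ψ, Γ Ψ⟫_ℂ := by
  -- The range of `Γ` is orthogonal to `Φ - Ψ`.
  have key : ∀ Θ : Fock, ⟪Γ Θ, Φ⟫_ℂ = ⟪Γ Θ, Ψ⟫_ℂ := fun Θ => by
    rw [lp.inner_eq_tsum, lp.inner_eq_tsum]
    refine tsum_congr fun n => ?_
    rcases le_or_gt (n : ℝ) M with hn | hn
    · rw [h n hn]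
    · rw [hM Θ n hn, inner_zero_left, inner_zero_left]
  rw [← hΓ.inner_left_eq_inner_right, key, hΓ.inner_left_eq_inner_right,
    ← inner_conj_symm Φ, key, inner_conj_symm]

/-- Partial sums of the partial trace: the vectors `symProduct V φ eⱼ` are `‖φ‖` times an
orthonormal family. -/
theorem IsState.sum_inner_symProduct_le {Γ : Fock →L[ℂ] Fock} (hΓ : IsState Γ)
    (V : Submodule ℂ OneBody) (φ : FockOver V) {ι : Type} {e : ι → FockOver Vᗮ}
    (he : Orthonormal ℂ e) (s : Finset ι) :
    ∑ i ∈ s, (⟪symProduct V φ (e i), Γ (symProduct V φ (e i))⟫_ℂ).re ≤ ‖φ‖ ^ 2 := by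
  classical
  by_cases hφ : φ = 0
  · subst hφ
    have h0 : ∀ χ, symProduct V 0 χ = 0 := fun χ => by
      have := congrArg (fun f => f χ) (map_zero (symProductₗ V))
      exact this
    simp [h0]
  have hn : (‖φ‖ : ℂ) ≠ 0 := by simpa using hφ
  have ho : Orthonormal ℂ fun i => (‖φ‖ : ℂ)⁻¹ • symProduct V φ (e i) := by
    rw [orthonormal_iff_ite]
    intro i j
    rw [inner_smul_left, inner_smul_right, inner_symProduct, orthonormal_iff_ite.1 he i j,
      inner_self_eq_norm_sq_to_K, map_inv₀, Complex.conj_ofReal]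
    split_ifs
    · simp only [Complex.coe_algebraMap]
      field_simp
    · simp
  have h := hΓ.sum_inner_le_one ho s
  have h2 : ∀ i, (⟪(‖φ‖ : ℂ)⁻¹ • symProduct V φ (e i),
      Γ ((‖φ‖ : ℂ)⁻¹ • symProduct V φ (e i))⟫_ℂ).re =
      (‖φ‖ ^ 2)⁻¹ * (⟪symProduct V φ (e i), Γ (symProduct V φ (e i))⟫_ℂ).re := fun i => by
    rw [map_smul, inner_smul_left, inner_smul_right, map_inv₀, Complex.conj_ofReal, ← mul_assoc,
      ← mul_inv, ← pow_two, ← Complex.ofReal_pow, ← Complex.ofReal_inv, Complex.re_ofReal_mul]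
  simp only [h2, ← Finset.mul_sum] at h
  have hpos : 0 < ‖φ‖ ^ 2 := by positivity
  rwa [inv_mul_le_iff₀ hpos, mul_one] at h

/-- If `Γ` has at most `M` particles, then `⟪φ, Γ_P φ⟫` is at most the weight of `φ` on the sectors
with at most `M` particles. -/
theorem IsState.inner_localization_le {Γ : Fock →L[ℂ] Fock} (hΓ : IsState Γ) {M : ℝ}
    (hM : SupportedBelow Γ M) (V : Submodule ℂ OneBody) (φ : FockOver V) :
    (⟪φ, localization Γ V φ⟫_ℂ).re ≤
      ∑ n ∈ Finset.range (⌊M⌋₊ + 1), ‖incl V φ n‖ ^ 2 := by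
  rw [← norm_truncateOver_sq]
  let hb := exists_hilbertBasis ℂ (FockOver Vᗮ)
  let A : hb.choose → FockOver V →L[ℂ] FockOver V := fun j =>
    (tensorRight (j : FockOver Vᗮ)).adjoint ∘L
      ((fockUnitaryInv V).adjoint ∘L Γ ∘L fockUnitaryInv V) ∘L tensorRight (j : FockOver Vᗮ)
  have hA : ∀ j, ⟪φ, A j φ⟫_ℂ = ⟪symProduct V (truncateOver (⌊M⌋₊ + 1) φ) j,
      Γ (symProduct V (truncateOver (⌊M⌋₊ + 1) φ) j)⟫_ℂ := fun j => by
    have h1 : ⟪φ, A j φ⟫_ℂ = ⟪symProduct V φ j, Γ (symProduct V φ j)⟫_ℂ := by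
      simp only [A, ContinuousLinearMap.comp_apply, ContinuousLinearMap.adjoint_inner_right,
        fockUnitaryInv_apply]
    rw [h1]
    refine inner_eq_of_supportedBelow hΓ.isPositive hM fun n hn => ?_
    rw [symProduct_truncateOver_apply (Nat.lt_succ_of_le (Nat.le_floor hn))]
  have ho : Orthonormal ℂ (fun j : hb.choose => (j : FockOver Vᗮ)) := by
    obtain ⟨b, h⟩ := hb.choose_spec
    have := b.orthonormal
    rwa [h] at this
  change (⟪φ, (∑' j, A j) φ⟫_ℂ).re ≤ _
  by_cases hs : Summable A
  · have h1 : HasSum (fun j => (⟪φ, A j φ⟫_ℂ).re) (⟪φ, (∑' j, A j) φ⟫_ℂ).re :=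
      Complex.hasSum_re (hs.hasSum.mapL ((innerSL ℂ φ) ∘L ContinuousLinearMap.apply ℂ _ φ))
    refine hasSum_le_of_sum_le h1 fun s => ?_
    simp only [hA]
    exact hΓ.sum_inner_symProduct_le V _ ho s
  · -- A series of operators that diverges in norm has the junk sum `0`, for which the bound is
    -- trivial.
    rw [tsum_eq_zero_of_not_summable hs]
    simp only [zero_apply, inner_zero_right, Complex.zero_re]
    positivity

theorem norm_coherent_apply_sq (u : OneBody) (n : ℕ) :
    ‖coherent u n‖ ^ 2 = Real.exp (-‖u‖ ^ 2) * (‖u‖ ^ 2) ^ n / n.factorial := by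
  have hn : ‖tensorPower u n‖ = ‖u‖ ^ n := by
    change ‖tensor fun _ : Fin n => u‖ = _
    rw [norm_tensor]; simp
  change ‖(((Real.exp (-‖u‖ ^ 2 / 2) / √(n.factorial : ℝ) : ℝ) : ℂ)) • tensorPower u n‖ ^ 2 = _
  rw [norm_smul, hn, Complex.norm_real, Real.norm_eq_abs, abs_of_nonneg (by positivity), mul_pow,
    div_pow, Real.sq_sqrt (Nat.cast_nonneg _), ← Real.exp_nat_mul]
  have : ((2 : ℕ) : ℝ) * (-‖u‖ ^ 2 / 2) = -‖u‖ ^ 2 := by push_cast; ring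
  rw [this, ← pow_mul, ← pow_mul, mul_comm 2 n]
  ring

/-! ### Lebesgue measure on a finite-dimensional subspace -/

theorem norm_sq_sum_smul {ι E : Type*} [Fintype ι] [NormedAddCommGroup E] [InnerProductSpace ℂ E]
    (b : OrthonormalBasis ι ℂ E) (z : ι → ℂ) : ‖∑ i, z i • b i‖ ^ 2 = ∑ i, ‖z i‖ ^ 2 := by
  have h := b.sum_repr_symm (WithLp.toLp 2 z)
  rw [show ∑ i, z i • b i = b.repr.symm (WithLp.toLp 2 z) from h, LinearIsometryEquiv.norm_map,
    EuclideanSpace.norm_sq_eq]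

theorem lintegral_lebesgue_gaussian (V : Submodule ℂ OneBody) [FiniteDimensional ℂ V] {c : ℝ}
    (hc : 0 < c) :
    ∫⁻ u, ENNReal.ofReal (Real.exp (-c * ‖u‖ ^ 2)) ∂(lebesgue V) =
      ENNReal.ofReal ((Real.pi / c) ^ Module.finrank ℂ V) := by
  have hg : Measurable fun u : V => ENNReal.ofReal (Real.exp (-c * ‖u‖ ^ 2)) :=
    (Continuous.measurable (by fun_prop)).ennreal_ofReal
  have hf : Measurable fun z : Fin (Module.finrank ℂ V) → ℂ =>
      ∑ i, z i • stdOrthonormalBasis ℂ V i := Continuous.measurable (by fun_prop)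
  have hnorm : ∀ z : Fin (Module.finrank ℂ V) → ℂ,
      Real.exp (-c * ‖∑ i, z i • stdOrthonormalBasis ℂ V i‖ ^ 2) =
        ∏ i, Real.exp (-c * ‖z i‖ ^ 2) := fun z => by
    rw [← Real.exp_sum, ← Finset.mul_sum,
      norm_sq_sum_smul (stdOrthonormalBasis ℂ V)]
  have h1 : Integrable fun z : ℂ => Real.exp (-c * ‖z‖ ^ 2) := by
    refine Integrable.of_integral_ne_zero ?_
    rw [GaussianFourier.integral_rexp_neg_mul_sq_norm hc]
    positivity
  have h2 : Integrable fun z : Fin (Module.finrank ℂ V) → ℂ =>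
      ∏ i, Real.exp (-c * ‖z i‖ ^ 2) := Integrable.fintype_prod fun _ => h1
  rw [lebesgue, lintegral_map hg hf]
  simp only [hnorm]
  rw [← ofReal_integral_eq_lintegral_ofReal h2
    (Filter.Eventually.of_forall fun z => by positivity),
    integral_fintype_prod_volume_eq_pow (fun z : ℂ => Real.exp (-c * ‖z‖ ^ 2)),
    GaussianFourier.integral_rexp_neg_mul_sq_norm hc]
  simp

/-! ### Estimates on real numbers -/

/-- Chernoff bound: the probability that a Poisson variable with mean `x` is at most `M`. -/
theorem poisson_sum_le {s x M : ℝ} (hs : 1 ≤ s) (hx : 0 ≤ x) (hM : 0 ≤ M) :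
    ∑ n ∈ Finset.range (⌊M⌋₊ + 1), Real.exp (-x) * x ^ n / n.factorial ≤
      Real.exp (M * Real.log s - (1 - s⁻¹) * x) := by
  have hs0 : 0 < s := by linarith
  have h1 : ∀ n ∈ Finset.range (⌊M⌋₊ + 1), Real.exp (-x) * x ^ n / n.factorial ≤
      Real.exp (-x) * Real.exp (M * Real.log s) * ((s⁻¹ * x) ^ n / n.factorial) := by
    intro n hn
    have hnM : (n : ℝ) ≤ M :=
      (Nat.le_floor_iff hM).1 (Nat.lt_succ_iff.1 (Finset.mem_range.1 hn))
    have h2 : s ^ n ≤ Real.exp (M * Real.log s) := by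
      rw [← Real.exp_log hs0, ← Real.exp_nat_mul, Real.log_exp]
      exact Real.exp_le_exp.2 (mul_le_mul_of_nonneg_right hnM (Real.log_nonneg hs))
    calc Real.exp (-x) * x ^ n / n.factorial
        = Real.exp (-x) * s ^ n * ((s⁻¹ * x) ^ n / n.factorial) := by
          rw [mul_pow, inv_pow]; field_simp
      _ ≤ _ := by gcongr
  refine (Finset.sum_le_sum h1).trans ?_
  rw [← Finset.mul_sum]
  refine (mul_le_mul_of_nonneg_left
    (Real.sum_le_exp_of_nonneg (mul_nonneg (inv_nonneg.2 hs0.le) hx) _)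
    (by positivity)).trans_eq ?_
  rw [← Real.exp_add, ← Real.exp_add]
  ring_nf

/-- The rate `(R - K²) - K² log (R / K²)` of the Chernoff bound at `M = K² τ`, `x = R τ`. -/
noncomputable def rate (K R : ℝ) : ℝ := (R - K ^ 2) - K ^ 2 * Real.log (R / K ^ 2)

theorem rate_pos {K R : ℝ} (hK : 0 < K) (hR : K ^ 2 < R) : 0 < rate K R := by
  have hK2 : 0 < K ^ 2 := by positivity
  have h := Real.log_lt_sub_one_of_pos (x := R / K ^ 2) (div_pos (hK2.trans hR) hK2)
    ((one_lt_div hK2).2 hR).ne'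
  have h2 := mul_lt_mul_of_pos_left h hK2
  have h3 : K ^ 2 * (R / K ^ 2 - 1) = R - K ^ 2 := by field_simp
  rw [rate]
  linarith

/-- Half of the Chernoff rate is kept as decay in `τ`, the other half as Gaussian decay in `x`. -/
theorem poisson_sum_le_exp_rate {K R τ x : ℝ} (hK : 0 < K) (hR : K ^ 2 < R) (hτ : 0 < τ)
    (hx : R * τ ≤ x) :
    ∑ n ∈ Finset.range (⌊K ^ 2 * τ⌋₊ + 1), Real.exp (-x) * x ^ n / n.factorial ≤
      Real.exp (-(rate K R / 2) * τ) * Real.exp (-(rate K R / (2 * R)) * x) := by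
  have hK2 : 0 < K ^ 2 := by positivity
  have hR0 : 0 < R := hK2.trans hR
  have hs : 1 ≤ R / K ^ 2 := ((one_lt_div hK2).2 hR).le
  refine (poisson_sum_le hs ((mul_pos hR0 hτ).le.trans hx) (by positivity)).trans ?_
  rw [← Real.exp_add, Real.exp_le_exp]
  have hlog : 0 ≤ K ^ 2 * Real.log (R / K ^ 2) := mul_nonneg hK2.le (Real.log_nonneg hs)
  have hk : rate K R ≤ R - K ^ 2 := by rw [rate]; linarith
  have hcoef : 1 - (R / K ^ 2)⁻¹ - rate K R / (2 * R) = (R - K ^ 2 - rate K R / 2) / R := by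
    field_simp
  have h1 : (R - K ^ 2 - rate K R / 2) * τ ≤
      (1 - (R / K ^ 2)⁻¹ - rate K R / (2 * R)) * x := by
    rw [hcoef]
    refine le_trans (le_of_eq ?_) (mul_le_mul_of_nonneg_left hx (div_nonneg ?_ hR0.le))
    · field_simp
    · linarith
  have h2 : K ^ 2 * τ * Real.log (R / K ^ 2) = (R - K ^ 2 - rate K R) * τ := by
    rw [rate]; ring
  rw [h2]
  linarith

/-- The growth `a ^ J` in the dimension is subexponential in `τ`. -/
theorem pow_le_exp_of_le_rpow {a κ τ : ℝ} (ha : 0 < a) (hκ : 0 < κ) {J : ℕ} (hτ : 1 ≤ τ)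
    (hJ : (J : ℝ) ≤ τ ^ (1 / 8 : ℝ)) :
    a ^ J ≤ Real.exp (Real.log a ^ 2 / κ) * Real.exp (κ / 4 * τ) := by
  -- For `1 ≤ τ` the exponent `1 / 2` already suffices, by completing the square.
  have h8 : τ ^ (1 / 8 : ℝ) ≤ √τ := by
    rw [Real.sqrt_eq_rpow]
    exact Real.rpow_le_rpow_of_exponent_le hτ (by norm_num)
  have h1 : J * Real.log a ≤ √τ * |Real.log a| :=
    (mul_le_mul_of_nonneg_left (le_abs_self _) (Nat.cast_nonneg J)).trans
      (mul_le_mul_of_nonneg_right (hJ.trans h8) (abs_nonneg _))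
  have h2 : √τ * |Real.log a| ≤ Real.log a ^ 2 / κ + κ / 4 * τ := by
    have h3 : 0 ≤ (|Real.log a| - κ / 2 * √τ) ^ 2 / κ := by positivity
    have h4 : (|Real.log a| - κ / 2 * √τ) ^ 2 / κ =
        Real.log a ^ 2 / κ + κ / 4 * τ - √τ * |Real.log a| := by
      rw [sub_sq, mul_pow, Real.sq_sqrt (by linarith : 0 ≤ τ), sq_abs]
      field_simp
      ring
    linarith
  rw [← Real.exp_add, ← Real.exp_log ha, ← Real.exp_nat_mul, Real.log_exp]
  exact Real.exp_le_exp.2 (h1.trans h2)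

theorem pow_six_le_exp {c t : ℝ} (hc : 0 < c) :
    t ^ 6 ≤ 48 / c ^ 3 * Real.exp (c / 2 * t ^ 2) := by
  have h := Real.pow_div_factorial_le_exp (x := c / 2 * t ^ 2) (by positivity) 3
  have h2 : t ^ 6 = 48 / c ^ 3 * ((c / 2 * t ^ 2) ^ 3 / (Nat.factorial 3 : ℕ)) := by
    norm_num [Nat.factorial]
    field_simp
    ring
  rw [h2]
  gcongr

/-! ### The bound on the lower symbol -/

/-- Gaussian bound on the density of the lower symbol outside the ball of radius `√R`. -/
theorem lowerSymbol_density_le {K R τ : ℝ} (hK : 0 < K) (hR : K ^ 2 < R) (hτ : 0 < τ)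
    {Γ : Fock →L[ℂ] Fock} (hΓ : IsState Γ) (hM : SupportedBelow Γ (K ^ 2 * τ))
    (V : Submodule ℂ OneBody) (u : V) (hu : R < ‖u‖ ^ 2) :
    (⟪coherentOver V (((√τ⁻¹)⁻¹ : ℂ) • u),
        localization Γ V (coherentOver V (((√τ⁻¹)⁻¹ : ℂ) • u))⟫_ℂ).re ≤
      Real.exp (-(rate K R / 2) * τ) * Real.exp (-(rate K R / (2 * R)) * (τ * ‖u‖ ^ 2)) := by
  have hnorm : ‖((((√τ⁻¹)⁻¹ : ℂ) • u : V) : OneBody)‖ ^ 2 = τ * ‖u‖ ^ 2 := by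
    rw [Submodule.norm_coe, norm_smul, mul_pow, norm_inv, Complex.norm_real, Real.norm_eq_abs,
      abs_of_nonneg (Real.sqrt_nonneg _), inv_pow, Real.sq_sqrt (by positivity), inv_inv]
  refine (hΓ.inner_localization_le hM V _).trans ?_
  refine le_trans (le_of_eq ?_) (poisson_sum_le_exp_rate hK hR hτ (x := τ * ‖u‖ ^ 2) ?_)
  · refine Finset.sum_congr rfl fun n _ => ?_
    rw [← hnorm]
    exact norm_coherent_apply_sq _ n
  · rw [mul_comm]
    exact mul_le_mul_of_nonneg_left hu.le hτ.le

/-- The truncated sixth moment of the lower symbol, with the dependence on the dimension. -/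
theorem lintegral_lowerSymbol_le {K R τ : ℝ} (hK : 0 < K) (hR : K ^ 2 < R) (hτ : 0 < τ)
    {Γ : Fock →L[ℂ] Fock} (hΓ : IsState Γ) (hM : SupportedBelow Γ (K ^ 2 * τ))
    (V : Submodule ℂ OneBody) [FiniteDimensional ℂ V] :
    ∫⁻ u in {u : V | R < ‖u‖ ^ 2}, ENNReal.ofReal (‖u‖ ^ 6) ∂(lowerSymbol τ⁻¹ Γ V) ≤
      ENNReal.ofReal (48 / (rate K R / (2 * R) * τ) ^ 3 *
        (2 / (rate K R / (2 * R))) ^ Module.finrank ℂ V * Real.exp (-(rate K R / 2) * τ)) := by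
  set κ := rate K R with hκdef
  set b := κ / (2 * R) with hbdef
  have hκ : 0 < κ := rate_pos hK hR
  have hR0 : 0 < R := (by positivity : 0 < K ^ 2).trans hR
  have hb : 0 < b := by positivity
  set J := Module.finrank ℂ V
  have hS : MeasurableSet {u : V | R < ‖u‖ ^ 2} :=
    measurableSet_lt measurable_const (Continuous.measurable (by fun_prop))
  let g : V → ENNReal := fun u =>
    ENNReal.ofReal ((τ / Real.pi) ^ J * Real.exp (-(κ / 2) * τ) *
      Real.exp (-b * (τ * ‖u‖ ^ 2)))
  have hg : Measurable g := (Continuous.measurable (by fun_prop)).ennreal_ofReal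
  -- Enlarging the density avoids any question of measurability of the Husimi function.
  have hle : (lowerSymbol τ⁻¹ Γ V).restrict {u : V | R < ‖u‖ ^ 2} ≤
      ((lebesgue V).restrict {u : V | R < ‖u‖ ^ 2}).withDensity g := by
    rw [lowerSymbol, restrict_withDensity hS]
    refine withDensity_mono ?_
    filter_upwards [ae_restrict_mem hS] with u hu
    refine ENNReal.ofReal_le_ofReal ?_
    rw [mul_assoc, ← inv_pow, mul_inv, inv_inv, ← div_eq_mul_inv]
    exact mul_le_mul_of_nonneg_left (lowerSymbol_density_le hK hR hτ hΓ hM V u hu) (by positivity)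
  refine (lintegral_mono' hle le_rfl).trans ?_
  rw [lintegral_withDensity_eq_lintegral_mul _ hg
    (Continuous.measurable (by fun_prop)).ennreal_ofReal]
  refine (setLIntegral_le_lintegral _ _).trans ?_
  set D := (τ / Real.pi) ^ J * Real.exp (-(κ / 2) * τ) * (48 / (b * τ) ^ 3) with hD
  have hD0 : 0 ≤ D := by positivity
  have hpt : ∀ u : V, (g * fun u : V => ENNReal.ofReal (‖u‖ ^ 6)) u ≤
      ENNReal.ofReal D * ENNReal.ofReal (Real.exp (-(b * τ / 2) * ‖u‖ ^ 2)) := fun u => by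
    rw [Pi.mul_apply, ← ENNReal.ofReal_mul (by positivity), ← ENNReal.ofReal_mul hD0]
    refine ENNReal.ofReal_le_ofReal ?_
    refine (mul_le_mul_of_nonneg_left (pow_six_le_exp (mul_pos hb hτ)) (by positivity)).trans_eq ?_
    have he : Real.exp (-(b * τ / 2) * ‖u‖ ^ 2) =
        Real.exp (-b * (τ * ‖u‖ ^ 2)) * Real.exp (b * τ / 2 * ‖u‖ ^ 2) := by
      rw [← Real.exp_add]; ring_nf
    rw [he, hD]
    ring
  refine (lintegral_mono hpt).trans ?_
  rw [lintegral_const_mul _ (Continuous.measurable (by fun_prop)).ennreal_ofReal,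
    lintegral_lebesgue_gaussian V (by positivity), ← ENNReal.ofReal_mul hD0]
  refine ENNReal.ofReal_le_ofReal (le_of_eq ?_)
  have hJ : (τ / Real.pi) ^ J * (Real.pi / (b * τ / 2)) ^ J = (2 / b) ^ J := by
    rw [← mul_pow]
    congr 1
    field_simp
  rw [hD, ← hJ]
  ring

end BoseFock

theorem lemma3p4 (K R : ℝ) (hK : 0 < K) (hR : K ^ 2 < R) :
    ∃ C c : ℝ, 0 < C ∧ 0 < c ∧
      ∀ (τ : ℝ), 0 < τ →
      ∀ Γ : BoseFock.Fock →L[ℂ] BoseFock.Fock,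
        BoseFock.IsState Γ → BoseFock.SupportedBelow Γ (K ^ 2 * τ) →
      ∀ P : BoseFock.OneBody →L[ℂ] BoseFock.OneBody, IsStarProjection P →
      ∀ [FiniteDimensional ℂ P.range] (J : ℕ), Module.finrank ℂ P.range = J →
        (J : ℝ) ≤ τ ^ (1 / 8 : ℝ) →
        ∫⁻ u in {u : P.range | R < ‖P u‖ ^ 2}, ENNReal.ofReal (‖P u‖ ^ 6)
            ∂(BoseFock.lowerSymbol τ⁻¹ Γ P.range) ≤
          ENNReal.ofReal (C * Real.exp (-c * τ)) := by
  have hκ := BoseFock.rate_pos hK hR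
  have hR0 : 0 < R := (by positivity : 0 < K ^ 2).trans hR
  set κ := BoseFock.rate K R with hκdef
  have hb : 0 < κ / (2 * R) := by positivity
  refine ⟨48 / (κ / (2 * R)) ^ 3 * Real.exp (Real.log (2 / (κ / (2 * R))) ^ 2 / κ), κ / 4,
    by positivity, by positivity, ?_⟩
  intro τ hτ Γ hΓ hM P hP _ J hJ hJτ
  have hPu : ∀ u : P.range, ‖P u‖ = ‖u‖ := by
    rintro ⟨_, v, rfl⟩
    have h : P (P v) = P v := congrArg (fun T => T v) hP.isIdempotentElem
    exact congrArg norm h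
  simp only [hPu]
  rcases Nat.eq_zero_or_pos J with rfl | hJ1
  · -- In dimension zero the domain of integration is empty.
    have : Subsingleton P.range := Module.finrank_zero_iff.1 hJ
    have hempty : {u : P.range | R < ‖u‖ ^ 2} = ∅ := by
      ext u
      simp [Subsingleton.elim u 0, hR0.le]
    rw [hempty, Measure.restrict_empty, lintegral_zero_measure]
    exact zero_le
  have hτ1 : 1 ≤ τ := by
    by_contra! h
    have h1 : τ ^ (1 / 8 : ℝ) < 1 := Real.rpow_lt_one hτ.le h (by norm_num)
    have h2 : (1 : ℝ) ≤ J := by exact_mod_cast hJ1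
    linarith
  refine (BoseFock.lintegral_lowerSymbol_le hK hR hτ hΓ hM P.range).trans
    (ENNReal.ofReal_le_ofReal ?_)
  rw [hJ, ← hκdef]
  have h1 := BoseFock.pow_le_exp_of_le_rpow (a := 2 / (κ / (2 * R))) (by positivity) hκ hτ1 hJτ
  have h2 : 48 / (κ / (2 * R) * τ) ^ 3 ≤ 48 / (κ / (2 * R)) ^ 3 := by
    gcongr
    exact le_mul_of_one_le_right hb.le hτ1
  calc _ ≤ 48 / (κ / (2 * R)) ^ 3 * (Real.exp (Real.log (2 / (κ / (2 * R))) ^ 2 / κ) *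
        Real.exp (κ / 4 * τ)) * Real.exp (-(κ / 2) * τ) := by gcongr
    _ = _ := by
      rw [mul_assoc, mul_assoc, mul_assoc, ← Real.exp_add]
      ring_nf
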